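/- Throughout, for a commutative noetherian ring $R$, let $\operatorname{C}(R)$ be the class of finitely generated $R$-modules $M$ with $\operatorname{depth} M_{\mathfrak p}\ge\operatorname{depth} R_{\mathfrak p}$ for every prime ideal $\mathfrak p$ of $R$ (where $\operatorname{depth} 0=\infty$). The stable annihilator $\underline{\operatorname{ann}}_R(M)$ of a finitely generated $R$-module $M$ is the annihilator of the $R$-module obtained from $\operatorname{End}_R(M)$ by factoring out the endomorphisms that factor through a finitely generated projective $R$-module. For an ideal $I$ of $R$, let $\operatorname{C}_I(R)$ be the class of those $M\in\operatorname{C}(R)$ with $I\subseteq\underline{\operatorname{ann}}_R(M)$. For a class $\mathcal X$ of finitely generated $R$-modules, let $\Omega_R(\mathcal X)$ be the class of $R$-modules $N$ for which there is an exact sequence $0\to N\to P\to X\to 0$ with $X\in\mathcal X$ and $P$ a finitely generated projective $R$-module. If $R$ is local, $\Omega_R^nM$ denotes the $n$-th syzygy of $M$ in a minimal free resolution $\cdots\to F_1\to F_0\to M\to0$, that is, the image of the map out of $F_n$ (so $\Omega_R^0M=M$). **Lemma.** Let $(R,\mathfrak m,k)$ be a commutative noetherian local ring, and let $t=\operatorname{depth}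 R$. Then the module $\Omega_R^tk$ belongs to $\Omega_R(\operatorname{C}_{\mathfrak m}(R))$. -/

import Mathlib

open CategoryTheory

universe u v

noncomputable section

namespace SyzygyCat

/-- The depth of a finitely generated module `M` over a (noetherian) local ring `R`: the supremum
of the lengths of the weakly `M`-regular sequences in the maximal ideal. For `M ≠ 0` finitely
generated, weakly regular sequences in the maximal ideal are the same as regular sequences
(Nakayama); for `M = 0` every sequence is weakly regular, so the depth is `∞`, as usual. -/
def depth (R : Type u) [CommRing R] [IsLocalRing R] (M : Type v) [AddCommGroup M] [Module R M] :
    ℕ∞ :=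
  ⨆ (rs : List R) (_ : ∀ r ∈ rs, r ∈ IsLocalRing.maximalIdeal R)
    (_ : RingTheory.Sequence.IsWeaklyRegular M rs), (rs.length : ℕ∞)

/-- The full subcategory `C(R)` of the finitely generated `R`-modules `M` such that
`depth M_𝔭 ≥ depth R_𝔭` for all prime ideals `𝔭`. -/
def CCat (R : Type u) [CommRing R] : ObjectProperty (ModuleCat.{u} R) := fun M =>
  Module.Finite R M ∧ ∀ (p : Ideal R) [p.IsPrime],
    depth (Localization.AtPrime p) (Localization.AtPrime p) ≤
      depth (Localization.AtPrime p) (LocalizedModule p.primeCompl M)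

/-- The endomorphisms of `M` that factor through a finitely generated projective module. -/
def projEnd (R : Type u) [CommRing R] (M : Type u) [AddCommGroup M] [Module R M] :
    Submodule R (Module.End R M) where
  carrier := {f | ∃ P : ModuleCat.{u} R, Module.Finite R P ∧ Module.Projective R P ∧
    ∃ (g : M →ₗ[R] P) (h : P →ₗ[R] M), f = h ∘ₗ g}
  zero_mem' := ⟨ModuleCat.of R PUnit.{u + 1},
    inferInstanceAs (Module.Finite R PUnit.{u + 1}),
    inferInstanceAs (Module.Projective R PUnit.{u + 1}), 0, 0, by simp⟩
  add_mem' := by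
    rintro _ _ ⟨P, hP, hP', g, h, rfl⟩ ⟨Q, hQ, hQ', g', h', rfl⟩
    refine ⟨ModuleCat.of R (P × Q), inferInstanceAs (Module.Finite R (P × Q)),
      inferInstanceAs (Module.Projective R (P × Q)), g.prod g', h.coprod h', ?_⟩
    ext x
    simp
  smul_mem' := by
    rintro a _ ⟨P, hP, hP', g, h, rfl⟩
    exact ⟨P, hP, hP', g, a • h, rfl⟩

/-- The stable annihilator of `M`: the annihilator of the stable endomorphism module, which is
`End M` modulo the endomorphisms factoring through a finitely generated projective module. -/
def stableAnnihilator (R : Type u) [CommRing R] (M : Type u) [AddCommGroup M] [Module R M] :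
    Ideal R :=
  Module.annihilator R (Module.End R M ⧸ projEnd R M)

/-- The full subcategory `mod_I(R)` of the finitely generated modules whose stable annihilator
contains `I`. -/
def modCat (R : Type u) [CommRing R] (I : Ideal R) : ObjectProperty (ModuleCat.{u} R) := fun M =>
  Module.Finite R M ∧ I ≤ stableAnnihilator R M

/-- `C_I(R) = C(R) ∩ mod_I(R)`. -/
def CICat (R : Type u) [CommRing R] (I : Ideal R) : ObjectProperty (ModuleCat.{u} R) :=
  CCat R ⊓ modCat R I

/-- The first syzygy category `Ω 𝒳`: the modules `N` for which there is an exact sequence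
`0 → N → P → X → 0` with `X` in `𝒳` and `P` finitely generated projective. -/
def syzygyCat {R : Type u} [CommRing R] (𝒳 : ObjectProperty (ModuleCat.{u} R)) :
    ObjectProperty (ModuleCat.{u} R) := fun N =>
  ∃ X P : ModuleCat.{u} R, 𝒳 X ∧ Module.Finite R P ∧ Module.Projective R P ∧
    ∃ (i : N →ₗ[R] P) (q : P →ₗ[R] X),
      Function.Injective i ∧ Function.Exact i q ∧ Function.Surjective q

/-- A minimal free resolution `⋯ → F₁ → F₀ → M → 0` of a module over a local ring, by finitely
generated free modules. -/
structure MinimalFreeResolution (R : Type u) [CommRing R] [IsLocalRing R]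
    (M : Type u) [AddCommGroup M] [Module R M] where
  obj : ℕ → ModuleCat.{u} R
  free : ∀ n, Module.Free R (obj n)
  finite : ∀ n, Module.Finite R (obj n)
  aug : obj 0 →ₗ[R] M
  d : ∀ n, obj (n + 1) →ₗ[R] obj n
  aug_surjective : Function.Surjective aug
  exact_aug : Function.Exact (d 0) aug
  exact_d : ∀ n, Function.Exact (d (n + 1)) (d n)
  minimal : ∀ n, LinearMap.range (d n) ≤ IsLocalRing.maximalIdeal R • (⊤ : Submodule R (obj n))

/-- The `n`-th syzygy `Ωⁿ M`, computed in a minimal free resolution of `M`: the image of the map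
out of the `n`-th free module. In particular `Ω⁰ M` is the image of `F₀ → M`, i.e. `M`. -/
def MinimalFreeResolution.syzygy {R : Type u} [CommRing R] [IsLocalRing R]
    {M : Type u} [AddCommGroup M] [Module R M] (F : MinimalFreeResolution R M) :
    ℕ → ModuleCat.{u} R
  | 0 => ModuleCat.of R (LinearMap.range F.aug)
  | n + 1 => ModuleCat.of R (LinearMap.range (F.d n))

/-- A finitely generated module over a local ring has a finite free cover with kernel in `𝔪 F`. -/
theorem exists_minimal_cover (R : Type u) [CommRing R] [IsLocalRing R]
    (M : Type u) [AddCommGroup M] [Module R M] [Module.Finite R M] :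
    ∃ (n : ℕ) (f : (Fin n → R) →ₗ[R] M), Function.Surjective f ∧
      LinearMap.ker f ≤ IsLocalRing.maximalIdeal R • (⊤ : Submodule R (Fin n → R)) := by
  classical
  let k := IsLocalRing.ResidueField R
  let b := Module.finBasis k (TensorProduct R k M)
  choose w hw using TensorProduct.mk_surjective R M k Ideal.Quotient.mk_surjective
  let v := fun i => w (b i)
  have hv : ∀ i, TensorProduct.tmul R (1 : k) (v i) = b i := fun i => hw (b i)
  refine ⟨_, Fintype.linearCombination R v, ?_, ?_⟩
  · rw [← LinearMap.range_eq_top, Fintype.range_linearCombination]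
    exact IsLocalRing.span_eq_top_of_tmul_eq_basis v b hv
  · intro c hc
    rw [LinearMap.mem_ker, Fintype.linearCombination_apply] at hc
    have h0 : ∑ i, algebraMap R k (c i) • b i = 0 := by
      have h1 := congrArg (TensorProduct.mk R k M 1) hc
      rw [map_sum, map_zero] at h1
      simpa [hv, algebraMap_smul] using h1
    have h2 := Fintype.linearIndependent_iff.mp b.linearIndependent _ h0
    have h3 : c = ∑ i, c i • (Pi.single i 1 : Fin _ → R) := by
      ext j
      simp [Finset.sum_apply, Pi.single_apply]
    rw [h3]
    exact Submodule.sum_mem _ fun i _ => Submodule.smul_mem_smul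
      ((IsLocalRing.residue_eq_zero_iff _).mp (h2 i)) trivial

/-- Minimal free resolutions exist. -/
theorem MinimalFreeResolution.nonempty (R : Type u) [CommRing R] [IsNoetherianRing R]
    [IsLocalRing R] (M : Type u) [AddCommGroup M] [Module R M] [Module.Finite R M] :
    Nonempty (MinimalFreeResolution R M) := by
  choose r f hf hk using fun K : {K : ModuleCat.{u} R // Module.Finite R K} =>
    haveI := K.2
    exists_minimal_cover R K.1
  let K : ℕ → {K : ModuleCat.{u} R // Module.Finite R K} := fun n =>
    Nat.rec ⟨ModuleCat.of R M, inferInstanceAs (Module.Finite R M)⟩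
      (fun _ K => ⟨ModuleCat.of R (LinearMap.ker (f K)),
        inferInstanceAs (Module.Finite R (LinearMap.ker (f K)))⟩) n
  let d : ∀ n, (Fin (r (K (n + 1))) → R) →ₗ[R] (Fin (r (K n)) → R) := fun n =>
    (LinearMap.ker (f (K n))).subtype ∘ₗ f (K (n + 1))
  have hr : ∀ n, LinearMap.range (d n) = LinearMap.ker (f (K n)) := fun n => by
    rw [LinearMap.range_comp, LinearMap.range_eq_top.mpr (hf (K (n + 1))), Submodule.map_top,
      Submodule.range_subtype]
  have hd : ∀ n, LinearMap.ker (d n) = LinearMap.ker (f (K (n + 1))) := fun n =>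
    LinearMap.ker_comp_of_ker_eq_bot _ (Submodule.ker_subtype _)
  exact ⟨{
    obj := fun n => ModuleCat.of R (Fin (r (K n)) → R)
    free := fun n => inferInstanceAs (Module.Free R (Fin (r (K n)) → R))
    finite := fun n => inferInstanceAs (Module.Finite R (Fin (r (K n)) → R))
    aug := f (K 0)
    d := d
    aug_surjective := hf (K 0)
    exact_aug := LinearMap.exact_iff.mpr (hr 0).symm
    exact_d := fun n => LinearMap.exact_iff.mpr ((hd n).trans (hr (n + 1)).symm)
    minimal := fun n => (hr n).le.trans (hk (K n)) }⟩

end SyzygyCat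

end

/-!
Let `k` be the residue field and `𝐱` a regular sequence of length `t = depth R` in `𝔪`. Since `𝐱`
is maximal, `R/(𝐱)` has depth zero and `k` embeds in it (`exists_injective_residueField`), which
gives an exact sequence `0 → k → R/(𝐱) → Y → 0`. Taking syzygies `t` times with the horseshoe lemma
(`exists_exact_ker_coprod`) yields `0 → Ωᵗ k → Q → X → 0`, where `Ωᵗ k` is the syzygy in the given
minimal resolution, `X` is a `t`-th syzygy of `Y`, and `Q` is projective because `R/(𝐱)` has
projective dimension `t`. This is the required sequence, provided `X` lies in `C_𝔪(R)`.

* Stable annihilator: for `a ∈ 𝔪`, multiplication by `a` on `Y` factors through `R/(𝐱)`, since `a`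
  kills the image of `k`. Such a factorization passes to syzygies (`SMulFactors.ker`), each time
  through a module of projective dimension one less, hence on `X` through a projective module.
* Depth at a prime `𝔭 ≠ 𝔪`: choosing `a ∈ 𝔪 \ 𝔭`, the factorization exhibits `X_𝔭` as a retract of a
  projective module (`SMulFactors.projective_localizedModule`), so regular sequences of `R_𝔭` are
  weakly regular on `X_𝔭`.
* Depth at `𝔪`: as a `t`-th syzygy, `X` has `𝐱` as a weakly regular sequence
  (`isWeaklyRegular_append_singleton_of_exact`).
-/

open RingTheory.Sequence IsLocalRing

namespace SyzygyCat

/-! ### Syzygies and projective dimension -/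

theorem hasProjectiveDimensionLE_ker {R : Type u} [CommRing R] {P Q : Type u}
    [AddCommGroup P] [Module R P] [AddCommGroup Q] [Module R Q] [Module.Projective R P]
    {f : P →ₗ[R] Q} (hf : Function.Surjective f) {n : ℕ}
    (hQ : HasProjectiveDimensionLE (ModuleCat.of R Q) (n + 1)) :
    HasProjectiveDimensionLE (ModuleCat.of R (LinearMap.ker f)) n := by
  have hP : Projective (ModuleCat.of R P) := (IsProjective.iff_projective P).mp inferInstance
  exact ((LinearMap.shortExact_shortComplexKer hf).hasProjectiveDimensionLT_X₃_iff n hP).mp hQ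

theorem projective_of_hasProjectiveDimensionLE_zero {R : Type u} [CommRing R] {Q : Type u}
    [AddCommGroup Q] [Module R Q] (hQ : HasProjectiveDimensionLE (ModuleCat.of R Q) 0) :
    Module.Projective R Q :=
  (IsProjective.iff_projective Q).mpr ((projective_iff_hasProjectiveDimensionLE_zero _).mpr hQ)

theorem exact_subtype_range_rangeRestrict {R : Type u} [CommRing R] {A B C : Type*}
    [AddCommGroup A] [Module R A] [AddCommGroup B] [Module R B] [AddCommGroup C] [Module R C]
    {f : A →ₗ[R] B} {g : B →ₗ[R] C} (h : Function.Exact f g) :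
    Function.Exact (LinearMap.range f).subtype g.rangeRestrict := by
  rw [LinearMap.exact_iff, LinearMap.ker_rangeRestrict, Submodule.range_subtype]
  exact LinearMap.exact_iff.mp h

theorem MinimalFreeResolution.exists_exact_syzygy {R : Type u} [CommRing R] [IsLocalRing R]
    {M : Type u} [AddCommGroup M] [Module R M] (F : MinimalFreeResolution R M) (n : ℕ) :
    ∃ (j : F.syzygy (n + 1) →ₗ[R] F.obj n) (p : F.obj n →ₗ[R] F.syzygy n),
      Function.Injective j ∧ Function.Exact j p ∧ Function.Surjective p := by
  cases n with
  | zero =>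
    exact ⟨(LinearMap.range (F.d 0)).subtype, F.aug.rangeRestrict, Subtype.val_injective,
      exact_subtype_range_rangeRestrict F.exact_aug, F.aug.surjective_rangeRestrict⟩
  | succ n =>
    exact ⟨(LinearMap.range (F.d (n + 1))).subtype, (F.d n).rangeRestrict, Subtype.val_injective,
      exact_subtype_range_rangeRestrict (F.exact_d n), (F.d n).surjective_rangeRestrict⟩

/-- The horseshoe lemma: from an exact sequence `0 → K → Q → Y → 0` and presentations of `K` and
`Y`, an exact sequence of syzygies. The middle syzygy is the kernel of a map `F × G → Q`. -/
theorem exists_exact_ker_coprod {R : Type u} [CommRing R] {K' F K Q G Y : Type u}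
    [AddCommGroup K'] [Module R K'] [AddCommGroup F] [Module R F] [AddCommGroup K] [Module R K]
    [AddCommGroup Q] [Module R Q] [AddCommGroup G] [Module R G] [AddCommGroup Y] [Module R Y]
    [Module.Projective R G]
    {u : K →ₗ[R] Q} {v : Q →ₗ[R] Y} (hu : Function.Injective u) (huv : Function.Exact u v)
    (hv : Function.Surjective v)
    {j : K' →ₗ[R] F} {p : F →ₗ[R] K} (hj : Function.Injective j) (hjp : Function.Exact j p)
    (hp : Function.Surjective p) {π : G →ₗ[R] Y} (hπ : Function.Surjective π) :
    ∃ φ : F × G →ₗ[R] Q, Function.Surjective φ ∧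
      ∃ (u' : K' →ₗ[R] LinearMap.ker φ) (v' : LinearMap.ker φ →ₗ[R] LinearMap.ker π),
        Function.Injective u' ∧ Function.Exact u' v' ∧ Function.Surjective v' := by
  obtain ⟨σ, hσ⟩ := Module.projective_lifting_property v π hv
  have hσ' (g : G) : v (σ g) = π g := LinearMap.congr_fun hσ g
  have huv0 (k : K) : v (u k) = 0 := huv.apply_apply_eq_zero k
  have hjp0 (k : K') : p (j k) = 0 := hjp.apply_apply_eq_zero k
  refine ⟨(u ∘ₗ p).coprod σ, fun q => ?_, ?_⟩
  · obtain ⟨g, hg⟩ := hπ (v q)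
    obtain ⟨k, hk⟩ := (huv (q - σ g)).mp (by rw [map_sub, hσ', hg, sub_self])
    obtain ⟨f, rfl⟩ := hp k
    exact ⟨(f, g), by simp [hk]⟩
  · let u' : K' →ₗ[R] LinearMap.ker ((u ∘ₗ p).coprod σ) :=
      (LinearMap.inl R F G ∘ₗ j).codRestrict _ fun k => by simp [hjp0]
    let v' : LinearMap.ker ((u ∘ₗ p).coprod σ) →ₗ[R] LinearMap.ker π :=
      (LinearMap.snd R F G).restrict fun x hx => by
        have h := congrArg v (LinearMap.mem_ker.mp hx)
        simpa [hσ', huv0] using h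
    refine ⟨u', v', fun a b hab => hj ?_, fun x => ⟨fun hx => ?_, ?_⟩, fun g => ?_⟩
    · exact congrArg (fun x => x.1.1) hab
    · obtain ⟨⟨f, g⟩, hfg⟩ := x
      obtain rfl : g = 0 := congrArg Subtype.val hx
      have h0 : u (p f) = 0 := by simpa using hfg
      obtain ⟨k, rfl⟩ := (hjp f).mp (hu (by rw [h0, map_zero]))
      exact ⟨k, rfl⟩
    · rintro ⟨k, rfl⟩
      rfl
    · obtain ⟨g, hg⟩ := g
      obtain ⟨k, hk⟩ := (huv (σ g)).mp (by rw [hσ', hg])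
      obtain ⟨f, rfl⟩ := hp k
      exact ⟨⟨(-f, g), by simp [hk]⟩, rfl⟩

/-! ### Multiplications that factor through modules of bounded projective dimension -/

/-- Multiplication by `a` on `M` factors through a finitely generated module of projective
dimension at most `n`. For `n = 0` this says that `a` is in the stable annihilator of `M`. -/
def SMulFactors (R : Type u) [CommRing R] (a : R) (n : ℕ) (M : Type u) [AddCommGroup M]
    [Module R M] : Prop :=
  ∃ Q : ModuleCat.{u} R, Module.Finite R Q ∧ HasProjectiveDimensionLE Q n ∧
    ∃ (g : M →ₗ[R] Q) (h : Q →ₗ[R] M), h ∘ₗ g = a • LinearMap.id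

theorem SMulFactors.mem_stableAnnihilator {R : Type u} [CommRing R] {a : R} {M : Type u}
    [AddCommGroup M] [Module R M] (ha : SMulFactors R a 0 M) : a ∈ stableAnnihilator R M := by
  obtain ⟨Q, hQ, hpd, g, h, hgh⟩ := ha
  rw [stableAnnihilator, Module.mem_annihilator]
  intro f
  obtain ⟨f, rfl⟩ := Submodule.Quotient.mk_surjective _ f
  rw [← Submodule.Quotient.mk_smul, Submodule.Quotient.mk_eq_zero]
  refine ⟨Q, hQ, projective_of_hasProjectiveDimensionLE_zero hpd, g ∘ₗ f, h, ?_⟩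
  rw [← LinearMap.comp_assoc, hgh, LinearMap.smul_comp, LinearMap.id_comp]

/-- Passing to a syzygy lowers the projective dimension in a factorization of `a • id`: the
factorization `M → Q → M` lifts to a projective module `G` onto `M` and a free module onto `Q`, the
lift differs from `a • id` on `G` by a map into the syzygy of `M`, and so on this syzygy `a • id`
factors through the sum of the syzygy of `Q` and `G`. -/
theorem SMulFactors.ker {R : Type u} [CommRing R] [IsNoetherianRing R] {a : R} {n : ℕ}
    {G M : Type u} [AddCommGroup G] [Module R G] [AddCommGroup M] [Module R M]
    [Module.Projective R G] [Module.Finite R G] {π : G →ₗ[R] M} (hπ : Function.Surjective π)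
    (ha : SMulFactors R a (n + 1) M) : SMulFactors R a n (LinearMap.ker π) := by
  obtain ⟨Q, hQ, hpd, g, h, hgh⟩ := ha
  obtain ⟨m, ρ, hρ⟩ := Module.Finite.exists_fin' R Q
  obtain ⟨g', hg'⟩ := Module.projective_lifting_property ρ (g ∘ₗ π) hρ
  obtain ⟨h', hh'⟩ := Module.projective_lifting_property π (h ∘ₗ ρ) hπ
  have hg (x : G) : ρ (g' x) = g (π x) := LinearMap.congr_fun hg' x
  have hh (x : Fin m → R) : π (h' x) = h (ρ x) := LinearMap.congr_fun hh' x
  have hgh (x : M) : h (g x) = a • x := LinearMap.congr_fun hgh x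
  let γ : LinearMap.ker π →ₗ[R] LinearMap.ker ρ :=
    g'.restrict fun x hx => by rw [LinearMap.mem_ker, hg, LinearMap.mem_ker.mp hx, map_zero]
  let η : LinearMap.ker ρ →ₗ[R] LinearMap.ker π :=
    h'.restrict fun x hx => by rw [LinearMap.mem_ker, hh, LinearMap.mem_ker.mp hx, map_zero]
  let θ : G →ₗ[R] LinearMap.ker π :=
    (a • LinearMap.id - h' ∘ₗ g').codRestrict _ fun x => by simp [hh, hg, hgh]
  refine ⟨ModuleCat.of R (LinearMap.ker ρ × G), inferInstanceAs (Module.Finite R (_ × _)), ?_,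
    γ.prod (LinearMap.ker π).subtype, η.coprod θ, ?_⟩
  · have h₁ : HasProjectiveDimensionLE (ModuleCat.of R (LinearMap.ker ρ)) n :=
      hasProjectiveDimensionLE_ker hρ hpd
    have h₂ : HasProjectiveDimensionLE (ModuleCat.of R G) n := by
      have : Projective (ModuleCat.of R G) := (IsProjective.iff_projective G).mp inferInstance
      exact hasProjectiveDimensionLT_of_ge _ 1 _ (by omega)
    have h₃ : HasProjectiveDimensionLT
        (ModuleCat.of R (LinearMap.ker ρ) ⊞ ModuleCat.of R G) (n + 1) := inferInstance
    exact hasProjectiveDimensionLT_of_iso (ModuleCat.biprodIsoProd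
      (ModuleCat.of R (LinearMap.ker ρ)) (ModuleCat.of R G)) (n + 1)
  · ext x
    simp [γ, η, θ]

/-! ### Regular sequences and depth -/

/-- A syzygy admits a longer weakly regular sequence than the module it resolves. -/
theorem isWeaklyRegular_append_singleton_of_exact {R : Type u} [CommRing R] {N G Y : Type u}
    [AddCommGroup N] [Module R N] [AddCommGroup G] [Module R G] [AddCommGroup Y] [Module R Y]
    {i : N →ₗ[R] G} {π : G →ₗ[R] Y} (hi : Function.Injective i) (hiπ : Function.Exact i π)
    (hπ : Function.Surjective π) {rs : List R} {r : R} (hY : IsWeaklyRegular Y rs)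
    (hG : IsWeaklyRegular G (rs ++ [r])) : IsWeaklyRegular N (rs ++ [r]) := by
  induction rs generalizing N G Y with
  | nil =>
    rw [List.nil_append, isWeaklyRegular_singleton_iff] at hG ⊢
    exact hG.of_injective i hi
  | cons s rs ih =>
    rw [List.cons_append, isWeaklyRegular_cons_iff] at hG ⊢
    rw [isWeaklyRegular_cons_iff] at hY
    refine ⟨hG.1.of_injective i hi, ih ?_ (QuotSMulTop.map_exact s hiπ hπ)
      (QuotSMulTop.map_surjective s hπ) hY.2 hG.2⟩
    -- Modulo `s`, injectivity of `i` persists because `s` is regular on the cokernel.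
    have h0 : Function.Exact (0 : PUnit.{u + 1} →ₗ[R] N) i := by
      rw [LinearMap.exact_iff, LinearMap.range_zero, LinearMap.ker_eq_bot.mpr hi]
    have h := QuotSMulTop.map_first_exact_on_four_term_exact_of_isSMulRegular_last h0 hiπ hY.1
    rw [map_zero, LinearMap.exact_iff, LinearMap.range_zero] at h
    exact LinearMap.ker_eq_bot.mp h

theorem length_le_depth {R : Type u} [CommRing R] [IsLocalRing R] {M : Type v} [AddCommGroup M]
    [Module R M] {rs : List R} (hrs : ∀ r ∈ rs, r ∈ maximalIdeal R) (h : IsWeaklyRegular M rs) :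
    (rs.length : ℕ∞) ≤ depth R M :=
  le_iSup_of_le rs (le_iSup_of_le hrs (le_iSup_of_le h le_rfl))

theorem depth_le_iff {R : Type u} [CommRing R] [IsLocalRing R] {M : Type v} [AddCommGroup M]
    [Module R M] {d : ℕ∞} :
    depth R M ≤ d ↔ ∀ rs : List R, (∀ r ∈ rs, r ∈ maximalIdeal R) → IsWeaklyRegular M rs →
      (rs.length : ℕ∞) ≤ d := by
  simp only [depth, iSup_le_iff]

theorem exists_isWeaklyRegular_length_eq {R : Type u} [CommRing R] [IsLocalRing R] {M : Type v}
    [AddCommGroup M] [Module R M] {t : ℕ} (ht : depth R M = t) :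
    ∃ rs : List R, (∀ r ∈ rs, r ∈ maximalIdeal R) ∧ IsWeaklyRegular M rs ∧ rs.length = t := by
  by_contra! hne
  cases t with
  | zero => exact hne [] (by simp) (.nil R M) rfl
  | succ t =>
    have hle : depth R M ≤ t := depth_le_iff.mpr fun rs hrs h => by
      have h₁ := length_le_depth hrs h
      rw [ht, Nat.cast_le] at h₁
      have h₂ := hne rs hrs h
      exact_mod_cast (by omega : rs.length ≤ t)
    rw [ht, Nat.cast_le] at hle
    omega

theorem isWeaklyRegular_of_flat {R : Type u} [CommRing R] {rs : List R}
    (h : IsWeaklyRegular R rs) (M : Type v) [AddCommGroup M] [Module R M] [Module.Flat R M] :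
    IsWeaklyRegular M rs :=
  ((TensorProduct.lid R M).isWeaklyRegular_congr rs).mp h.isWeaklyRegular_rTensor

theorem depth_self_le_depth_of_flat (R : Type u) [CommRing R] [IsLocalRing R] (M : Type v)
    [AddCommGroup M] [Module R M] [Module.Flat R M] : depth R R ≤ depth R M :=
  depth_le_iff.mpr fun _ hrs h => length_le_depth hrs (isWeaklyRegular_of_flat h M)

/-- The residue field embeds into the quotient of the ring by a weakly regular sequence of
maximal length, since by prime avoidance the maximal ideal is an associated prime there. -/
theorem exists_injective_residueField {R : Type u} [CommRing R] [IsNoetherianRing R]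
    [IsLocalRing R] {rs : List R} (hrs : ∀ r ∈ rs, r ∈ maximalIdeal R)
    (hreg : IsWeaklyRegular R rs) (hlen : depth R R = rs.length) :
    ∃ f : ResidueField R →ₗ[R] R ⧸ (Ideal.ofList rs • ⊤ : Submodule R R),
      Function.Injective f := by
  set Q := R ⧸ (Ideal.ofList rs • ⊤ : Submodule R R)
  have hsub : (maximalIdeal R : Set R) ⊆ ⋃ p ∈ associatedPrimes R Q, p := by
    rw [biUnion_associatedPrimes_eq_compl_regular]
    intro r hr (hr' : IsSMulRegular Q r)
    have h := (isWeaklyRegular_append_iff R rs [r]).mpr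
      ⟨hreg, (isWeaklyRegular_singleton_iff Q r).mpr hr'⟩
    have hle := length_le_depth (M := R) (by simpa [or_imp, forall_and] using ⟨hrs, hr⟩) h
    rw [hlen, Nat.cast_le, List.length_append, List.length_singleton] at hle
    omega
  obtain ⟨p, hp, hmp⟩ := (Ideal.subset_union_prime_finite (associatedPrimes.finite R Q)
    (f := id) 0 0 fun _ h _ _ => h.isPrime).mp hsub
  obtain rfl : maximalIdeal R = p := (maximalIdeal.isMaximal R).eq_of_le hp.isPrime.ne_top hmp
  exact ((isAssociatedPrime_iff_exists_injective_linearMap _ _).mp hp).2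

/-- At a prime avoiding some `a` for which `a • id` factors through a projective module, the
localization is a retract of a projective module. -/
theorem SMulFactors.projective_localizedModule {R : Type u} [CommRing R] {a : R} {M : Type u}
    [AddCommGroup M] [Module R M] (ha : SMulFactors R a 0 M) (p : Ideal R) [p.IsPrime]
    (hap : a ∉ p) :
    Module.Projective (Localization.AtPrime p) (LocalizedModule p.primeCompl M) := by
  obtain ⟨Q, -, hpd, g, h, hgh⟩ := ha
  have hQ := projective_of_hasProjectiveDimensionLE_zero hpd
  have hQ' : Module.Projective (Localization.AtPrime p) (LocalizedModule p.primeCompl Q) :=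
    Module.projective_of_isLocalizedModule p.primeCompl
      (LocalizedModule.mkLinearMap p.primeCompl Q)
  have hu : IsUnit (algebraMap R (Localization.AtPrime p) a) :=
    IsLocalization.map_units (Localization.AtPrime p) (⟨a, hap⟩ : p.primeCompl)
  obtain ⟨b, hb⟩ := hu.exists_left_inv
  refine Module.Projective.of_split (LocalizedModule.map p.primeCompl g)
    (b • LocalizedModule.map p.primeCompl h) ?_
  ext x
  induction x using LocalizedModule.induction_on with | _ m s =>
  have hgh' : h (g m) = a • m := LinearMap.congr_fun hgh m
  rw [LinearMap.comp_apply, LinearMap.smul_apply, LocalizedModule.map_mk, LocalizedModule.map_mk,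
    hgh', ← LocalizedModule.smul'_mk, ← algebraMap_smul (Localization.AtPrime p) a, smul_smul, hb,
    one_smul, LinearMap.id_apply]

/-- The depth inequality at the maximal ideal. Localizing there changes neither the ring nor the
module, so a maximal regular sequence of the ring that is also regular on the module suffices. -/
theorem depth_atPrime_maximalIdeal_le {R : Type u} [CommRing R] [IsLocalRing R] {M : Type u}
    [AddCommGroup M] [Module R M] {rs : List R} (hrs : ∀ r ∈ rs, r ∈ maximalIdeal R)
    (hreg : IsWeaklyRegular M rs) (hlen : depth R R = rs.length) :
    depth (Localization.AtPrime (maximalIdeal R)) (Localization.AtPrime (maximalIdeal R)) ≤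
      depth (Localization.AtPrime (maximalIdeal R))
        (LocalizedModule (maximalIdeal R).primeCompl M) := by
  set A := Localization.AtPrime (maximalIdeal R)
  let e : R ≃ₐ[R] A := IsLocalization.atUnits R (maximalIdeal R).primeCompl fun x hx =>
    notMem_maximalIdeal.mp hx
  have hM : IsWeaklyRegular (LocalizedModule (maximalIdeal R).primeCompl M)
      (rs.map (algebraMap R A)) :=
    hreg.of_isLocalizedModule A (maximalIdeal R).primeCompl
      (LocalizedModule.mkLinearMap (maximalIdeal R).primeCompl M)
  have hM' : ∀ r ∈ rs.map (algebraMap R A), r ∈ maximalIdeal A := by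
    simp only [List.forall_mem_map]
    exact fun r hr =>
      (IsLocalization.AtPrime.to_map_mem_maximal_iff A (maximalIdeal R) r).mpr (hrs r hr)
  refine le_trans (depth_le_iff.mpr fun l hl h => ?_) (length_le_depth hM' hM)
  have hl' : ∀ r ∈ l.map e.symm, r ∈ maximalIdeal R := by
    simp only [List.forall_mem_map]
    intro r hr
    rw [mem_maximalIdeal, mem_nonunits_iff, MulEquiv.isUnit_map]
    exact hl r hr
  have h' : IsWeaklyRegular R (l.map e.symm) :=
    (AddEquiv.isWeaklyRegular_congr (e := e.symm.toAddEquiv) (List.forall₂_map_right_iff.mpr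
      (List.forall₂_same.mpr fun r _ x => map_mul e.symm r x))).mp h
  rw [List.length_map, ← hlen]
  simpa only [List.length_map] using length_le_depth hl' h'

/-! ### The exact sequences resolving a quotient by a regular sequence -/

/-- The `i`-fold iteration of the horseshoe construction on `0 → k → R/(rs) → Y → 0`. Each step
lowers by one the projective dimension of the middle term, which is `rs.length` at the start, and
of the modules through which the maximal ideal acts on the right-hand term, and lengthens by one
the initial segment of `rs` known to be weakly regular on the right-hand term. At the start `𝔪`
kills the image of `k`, so for `a ∈ 𝔪` the map `a • id` on `Y` factors through `R/(rs)`. -/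
theorem MinimalFreeResolution.exists_exact_of_isWeaklyRegular {R : Type u} [CommRing R]
    [IsNoetherianRing R] [IsLocalRing R] (F : MinimalFreeResolution R (ResidueField R))
    {rs : List R} (hrs : ∀ r ∈ rs, r ∈ maximalIdeal R) (hreg : IsWeaklyRegular R rs)
    (hlen : depth R R = rs.length) (i n : ℕ) (hin : i + n = rs.length) :
    ∃ (Q Y : ModuleCat.{u} R) (u : F.syzygy i →ₗ[R] Q) (v : Q →ₗ[R] Y),
      Function.Injective u ∧ Function.Exact u v ∧ Function.Surjective v ∧ Module.Finite R Q ∧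
      HasProjectiveDimensionLE Q n ∧ (∀ a ∈ maximalIdeal R, SMulFactors R a n Y) ∧
      IsWeaklyRegular Y (rs.take i) := by
  induction i generalizing n with
  | zero =>
    obtain rfl : n = rs.length := by omega
    obtain ⟨f, hf⟩ := exists_injective_residueField hrs hreg hlen
    let Q := R ⧸ (Ideal.ofList rs • ⊤ : Submodule R R)
    have hpd : HasProjectiveDimensionLE (ModuleCat.of R Q) rs.length := by
      have h := ModuleCat.projectiveDimension_quotient_eq_add_length_of_isWeaklyRegular
        (ModuleCat.of R R) rs hreg hrs
      rw [ModuleCat.projectiveDimension_eq_zero_of_projective (ModuleCat.of R R), zero_add] at h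
      exact (projectiveDimension_le_iff _ _).mp h.le
    let u : F.syzygy 0 →ₗ[R] Q := f ∘ₗ (LinearMap.range F.aug).subtype
    have hu : Function.Injective u := hf.comp Subtype.val_injective
    refine ⟨ModuleCat.of R Q, ModuleCat.of R (Q ⧸ LinearMap.range u), u,
      (LinearMap.range u).mkQ, hu, LinearMap.exact_map_mkQ_range u, Submodule.mkQ_surjective _,
      inferInstanceAs (Module.Finite R Q), hpd, fun a ha => ?_, .nil R _⟩
    refine ⟨ModuleCat.of R Q, inferInstanceAs (Module.Finite R Q), hpd,
      (LinearMap.range u).liftQ (a • LinearMap.id) ?_, (LinearMap.range u).mkQ, ?_⟩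
    · rintro _ ⟨x, rfl⟩
      have hx (y : ResidueField R) : a • y = 0 := by
        rw [Algebra.smul_def, ResidueField.algebraMap_eq, (residue_eq_zero_iff a).mpr ha, zero_mul]
      change a • f x.1 = 0
      rw [← map_smul, hx, map_zero]
    · ext
      rfl
  | succ i ih =>
    obtain ⟨Q, Y, u, v, hu, huv, hv, hQ, hpd, hY, hYreg⟩ := ih (n + 1) (by omega)
    obtain ⟨j, p, hj, hjp, hp⟩ := F.exists_exact_syzygy i
    have := Module.Finite.of_surjective v hv
    have := F.free i
    have := F.finite i
    obtain ⟨m, π, hπ⟩ := Module.Finite.exists_fin' R Y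
    obtain ⟨φ, hφ, u', v', hu', huv', hv'⟩ := exists_exact_ker_coprod hu huv hv hj hjp hp hπ
    refine ⟨ModuleCat.of R (LinearMap.ker φ), ModuleCat.of R (LinearMap.ker π), u', v', hu', huv',
      hv', inferInstanceAs (Module.Finite R (LinearMap.ker φ)), hasProjectiveDimensionLE_ker hφ hpd,
      fun a ha => (hY a ha).ker hπ, ?_⟩
    have hG : IsWeaklyRegular (Fin m → R) (rs.take (i + 1)) := by
      have h := isWeaklyRegular_of_flat hreg (Fin m → R)
      rw [← List.take_append_drop (i + 1) rs] at h
      exact ((isWeaklyRegular_append_iff _ _ _).mp h).1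
    rw [List.take_succ_eq_append_getElem (by omega)] at hG ⊢
    exact isWeaklyRegular_append_singleton_of_exact Subtype.val_injective
      (LinearMap.exact_subtype_ker_map π) hπ hYreg hG

end SyzygyCat

theorem lemma2p17 (R : Type u) [CommRing R] [IsNoetherianRing R] [IsLocalRing R]
    (t : ℕ) (ht : SyzygyCat.depth R R = t)
    (F : SyzygyCat.MinimalFreeResolution R (IsLocalRing.ResidueField R)) :
    SyzygyCat.syzygyCat (SyzygyCat.CICat R (IsLocalRing.maximalIdeal R)) (F.syzygy t) := by
  obtain ⟨rs, hrs, hreg, rfl⟩ := SyzygyCat.exists_isWeaklyRegular_length_eq ht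
  obtain ⟨Q, Y, u, v, hu, huv, hv, hQ, hpd, hY, hYreg⟩ :=
    F.exists_exact_of_isWeaklyRegular hrs hreg ht rs.length 0 (add_zero _)
  rw [List.take_length] at hYreg
  have hYfin : Module.Finite R Y := Module.Finite.of_surjective v hv
  refine ⟨Y, Q, ⟨⟨hYfin, fun p hp => ?_⟩, hYfin, fun a ha => (hY a ha).mem_stableAnnihilator⟩,
    hQ, SyzygyCat.projective_of_hasProjectiveDimensionLE_zero hpd, u, v, hu, huv, hv⟩
  by_cases hpm : p = maximalIdeal R
  · subst hpm
    exact SyzygyCat.depth_atPrime_maximalIdeal_le hrs hYreg ht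
  · obtain ⟨a, ha, hap⟩ := SetLike.exists_of_lt
      (lt_of_le_of_ne (le_maximalIdeal hp.ne_top) hpm)
    have := (hY a ha).projective_localizedModule p hap
    have : Module.Flat (Localization.AtPrime p) (LocalizedModule p.primeCompl Y) :=
      Module.Flat.of_projective
    exact SyzygyCat.depth_self_le_depth_of_flat _ _
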